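/- Let $r\in\{3,4,\dots,\infty\}$ and $n\ge 2$. Let $(M,g)$ be a $C^r$ spacetime of dimension $n$, i.e. $M$ is a connected, Hausdorff, paracompact $C^r$ manifold of dimension $n$ (without boundary), with a $C^{r-1}$ Lorentzian metric $g$ of signature $(-,+,\dots,+)$ and a time orientation (given by a continuous timelike vector field). Let $I^{+}\subset M\times M$ be the set of pairs $(p,q)$ joined by a future-directed timelike piecewise $C^1$ curve from $p$ to $q$, and let $J^{+}$ be the set of pairs $(p,q)$ such that $p=q$ or there is a future-directed causal piecewise $C^1$ curve from $p$ to $q$. Let $\overline{J^{+}}$ be the closure of $J^+$ in $M\times M$, and let $K^{+}$ be the smallest closed and transitive relation on $M$ containing $J^{+}$. A utility for a transitive relation $R$ is a function $u:M\to\mathbb{R}$ such that $u(x)=u(y)$ whenever $(x,y)\in R$ and $(y,x)\in R$, and $u(x)<u(y)$ whenever $(x,y)\in R$ and $(y,x)\notin R$. A semi-time function is a continuous function $t:M\to\mathbb{R}$ such that $(p,q)\in I^{+}$ implies $t(p)<t(q)$. **Theorem.** Suppose that $(M,g)$ is chronological (i.e. $(p,p)\notin I^{+}$ for every $p\in M$)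 and that $\overline{J^{+}}$ is transitive. Then $K^{+}=\overline{J^{+}}$, there exists a continuous utility for $K^{+}$, and every continuous utility for $K^{+}$ is a semi-time function. In particular, $(M,g)$ admits a semi-time function. -/

import Mathlib

open Set Topology Bundle Manifold
open scoped ContDiff

/-- A time-oriented Lorentzian structure on a `C^r` manifold `M` of dimension `n` (without boundary):
a `C^(r-1)` metric tensor of signature `(-,+,…,+)` together with a time orientation, given by a
continuous timelike vector field `T`, which singles out the future timelike cone at each point.
The class `IsManifold (𝓡 n) 1 M` only serves to make the tangent bundle available. -/
structure LorentzianTimeOriented (n : ℕ) (r : ℕ∞) (M : Type*) [TopologicalSpace M]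
    [ChartedSpace (EuclideanSpace ℝ (Fin n)) M] [IsManifold (𝓡 n) 1 M] where
  /-- The metric tensor. -/
  g : ∀ x : M, TangentSpace (𝓡 n) x →L[ℝ] TangentSpace (𝓡 n) x →L[ℝ] ℝ
  symm : ∀ (x : M) (v w : TangentSpace (𝓡 n) x), g x v w = g x w v
  /-- At each point there is a basis in which the metric is `diag(-1, 1, …, 1)`. -/
  signature : ∀ x : M, ∃ b : Module.Basis (Fin n) ℝ (TangentSpace (𝓡 n) x), ∀ i j : Fin n,
    g x (b i) (b j) = if i = j then (if (i : ℕ) = 0 then -1 else 1) else 0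
  /-- The metric is a `C^(r-1)` section of the bundle of bilinear forms on the tangent spaces
  (with `∞ - 1 = ∞`). -/
  contMDiff_g : ContMDiff (𝓡 n)
    ((𝓡 n).prod 𝓘(ℝ, EuclideanSpace ℝ (Fin n) →L[ℝ] EuclideanSpace ℝ (Fin n) →L[ℝ] ℝ))
    ((r - 1 : ℕ∞) : ℕ∞ω)
    (fun x ↦ TotalSpace.mk'
      (EuclideanSpace ℝ (Fin n) →L[ℝ] EuclideanSpace ℝ (Fin n) →L[ℝ] ℝ)
      (E := fun x : M ↦ TangentSpace (𝓡 n) x →L[ℝ] TangentSpace (𝓡 n) x →L[ℝ] ℝ) x (g x))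
  /-- The vector field defining the time orientation. -/
  T : ∀ x : M, TangentSpace (𝓡 n) x
  continuous_T : Continuous (fun x ↦ (⟨x, T x⟩ : TangentBundle (𝓡 n) M))
  timelike_T : ∀ x : M, g x (T x) (T x) < 0

namespace LorentzianTimeOriented

variable {n : ℕ} {r : ℕ∞} {M : Type*} [TopologicalSpace M]
  [ChartedSpace (EuclideanSpace ℝ (Fin n)) M] [IsManifold (𝓡 n) 1 M]
  (S : LorentzianTimeOriented n r M)

/-- A tangent vector is future-directed timelike. -/
def IsFutureTimelike {x : M} (v : TangentSpace (𝓡 n) x) : Prop :=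
  S.g x v v < 0 ∧ S.g x (S.T x) v < 0

/-- A tangent vector is future-directed causal: nonzero, timelike or lightlike, and in the same
half of the cone as `T`. -/
def IsFutureCausal {x : M} (v : TangentSpace (𝓡 n) x) : Prop :=
  v ≠ 0 ∧ S.g x v v ≤ 0 ∧ S.g x (S.T x) v < 0

/-- The velocity at time `t` of a curve `γ` defined on `[a, b]` (one-sided at the end points). -/
noncomputable def velocity (n : ℕ) {M : Type*} [TopologicalSpace M]
    [ChartedSpace (EuclideanSpace ℝ (Fin n)) M] (γ : ℝ → M) (a b t : ℝ) :
    TangentSpace (𝓡 n) (γ t) :=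
  mfderivWithin 𝓘(ℝ, ℝ) (𝓡 n) γ (Icc a b) t (1 : ℝ)

/-- There is a future-directed timelike `C^1` curve from `p` to `q`. -/
def TimelikeSegment (p q : M) : Prop :=
  ∃ (γ : ℝ → M) (a b : ℝ), a < b ∧ γ a = p ∧ γ b = q ∧
    ContMDiffOn 𝓘(ℝ, ℝ) (𝓡 n) 1 γ (Icc a b) ∧
    ∀ t ∈ Icc a b, S.IsFutureTimelike (velocity n γ a b t)

/-- There is a future-directed causal `C^1` curve from `p` to `q`. -/
def CausalSegment (p q : M) : Prop :=
  ∃ (γ : ℝ → M) (a b : ℝ), a < b ∧ γ a = p ∧ γ b = q ∧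
    ContMDiffOn 𝓘(ℝ, ℝ) (𝓡 n) 1 γ (Icc a b) ∧
    ∀ t ∈ Icc a b, S.IsFutureCausal (velocity n γ a b t)

/-- The chronological relation `I⁺`: the pairs `(p, q)` such that there is a future-directed
timelike piecewise `C^1` curve (a concatenation of finitely many, at least one, timelike `C^1`
curves) from `p` to `q`. -/
def chronologicalRel : Set (M × M) :=
  {z | Relation.TransGen S.TimelikeSegment z.1 z.2}

/-- The causal relation `J⁺`: the pairs `(p, q)` such that `p = q` or there is a future-directed
causal piecewise `C^1` curve (a concatenation of finitely many, at least one, causal `C^1` curves)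
from `p` to `q`. -/
def causalRel : Set (M × M) :=
  {z | z.1 = z.2 ∨ Relation.TransGen S.CausalSegment z.1 z.2}

/-- No closed timelike curves. -/
def IsChronological : Prop :=
  ∀ p : M, (p, p) ∉ S.chronologicalRel

/-- A semi-time function: continuous and strictly increasing along the chronological relation. -/
def IsSemiTime (t : M → ℝ) : Prop :=
  Continuous t ∧ ∀ p q : M, (p, q) ∈ S.chronologicalRel → t p < t q

end LorentzianTimeOriented

/-- A utility for `R`: `x ∼_R y` implies `u x = u y`, and `x <_R y` implies `u x < u y`, where
`x ∼_R y` means `(x, y) ∈ R` and `(y, x) ∈ R`, and `x <_R y` means `(x, y) ∈ R` and not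
`x ∼_R y`. -/
def IsUtility {X : Type*} (R : Set (X × X)) (u : X → ℝ) : Prop :=
  (∀ x y : X, (x, y) ∈ R ∧ (y, x) ∈ R → u x = u y) ∧
  (∀ x y : X, (x, y) ∈ R ∧ ¬((x, y) ∈ R ∧ (y, x) ∈ R) → u x < u y)

/-- The relation `K⁺`: the smallest closed and transitive relation containing `J⁺`. -/
def LorentzianTimeOriented.kRel {n : ℕ} {r : ℕ∞} {M : Type*} [TopologicalSpace M]
    [ChartedSpace (EuclideanSpace ℝ (Fin n)) M] [IsManifold (𝓡 n) 1 M]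
    (S : LorentzianTimeOriented n r M) : Set (M × M) :=
  ⋂₀ {R : Set (M × M) | IsClosed R ∧ SetRel.IsTrans R ∧ S.causalRel ⊆ R}

/-! If $\overline{J^+}$ is transitive, it is itself the least closed transitive relation containing
$J^+$, so $K^+=\overline{J^+}$ is a closed preorder on a σ-compact, second countable, locally
compact Hausdorff space. The theorem then splits into an order-topological half and a Lorentzian
half.

Order half (`exists_continuous_isUtility`): closed down-sets can be separated from disjoint closed
up-sets along a compact exhaustion (`exists_open_closed_downset_between`). Urysohn's construction,
run with down-sets, gives an isotone function for each unrelated pair. By the Lindelöf property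
countably many of these detect every unrelated pair, and a geometrically weighted sum of them is a
utility.

Lorentzian half (`swap_notMem_closure_causalRel`): a utility increases strictly along $I^+$ once no
pair $(p,q)\in I^+$ has $(q,p)\in\overline{J^+}$. If one did, openness of $I^+$ would give nearby
$x,y$ with $(x,y)\in I^+$ and $(y,x)\in J^+$, and the push-up property $I^+\circ J^+\subseteq I^+$
would close up a timelike curve. Push-up rests on `exists_timelike_perturbation`, which bends the
last piece of a causal curve into a timelike one. -/

/-! ### Closed preorders: normality, isotone Urysohn functions, continuous utilities. -/

section ClosedPreorder

open Filter

variable {X : Type*} [TopologicalSpace X]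

/-- A connected, locally compact, paracompact Hausdorff space is `σ`-compact. -/
theorem sigmaCompactSpace_of_paracompact_of_connected [T2Space X] [LocallyCompactSpace X]
    [ParacompactSpace X] [ConnectedSpace X] : SigmaCompactSpace X := by
  choose N hN using fun x : X ↦ exists_compact_mem_nhds x
  obtain ⟨V, hVo, hVu, hVf, hVs⟩ := precise_refinement (fun x ↦ interior (N x))
    (fun x ↦ isOpen_interior)
    (eq_univ_of_forall fun x ↦ mem_iUnion.2 ⟨x, mem_interior_iff_mem_nhds.2 (hN x).2⟩)
  have hc (i : X) : IsCompact (closure (V i)) :=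
    (hN i).1.of_isClosed_subset isClosed_closure
      (closure_minimal ((hVs i).trans interior_subset) (hN i).1.isClosed)
  -- By local finiteness a compact set meets only finitely many `V i`. Iterating this enlargement
  -- from a point gives compact sets whose union is clopen, hence everything.
  have step (K : Set X) (hK : IsCompact K) :
      ∃ K', IsCompact K' ∧ ∀ i, (K ∩ V i).Nonempty → V i ⊆ K' := by
    have hfin : {i | (V i ∩ K).Nonempty}.Finite := hVf.finite_nonempty_inter_compact hK
    refine ⟨⋃ i ∈ {i | (V i ∩ K).Nonempty}, closure (V i), hfin.isCompact_biUnion fun i _ ↦ hc i,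
      fun i hi ↦ subset_closure.trans (subset_biUnion_of_mem (u := fun i ↦ closure (V i)) ?_)⟩
    simpa [inter_comm] using hi
  choose! f hf hfV using step
  obtain ⟨x₀⟩ : Nonempty X := inferInstance
  let K : ℕ → Set X := fun k ↦ f^[k] {x₀}
  have hK (k : ℕ) : IsCompact (K k) := by
    induction k with
    | zero => exact isCompact_singleton
    | succ k ih => simpa only [K, Function.iterate_succ_apply'] using hf _ ih
  have hKV (k : ℕ) (i : X) (h : (K k ∩ V i).Nonempty) : V i ⊆ K (k + 1) := by
    simpa only [K, Function.iterate_succ_apply'] using hfV _ (hK k) i h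
  have hmem (x : X) : ∃ i, x ∈ V i := mem_iUnion.1 (hVu ▸ mem_univ x)
  have hopen : IsOpen (⋃ k, K k) := by
    refine isOpen_iff_mem_nhds.2 fun x hx ↦ ?_
    obtain ⟨k, hk⟩ := mem_iUnion.1 hx
    obtain ⟨i, hi⟩ := hmem x
    exact mem_of_superset ((hVo i).mem_nhds hi)
      ((hKV k i ⟨x, hk, hi⟩).trans (subset_iUnion _ _))
  have hclosed : IsClosed (⋃ k, K k) := by
    refine isClosed_of_closure_subset fun x hx ↦ ?_
    obtain ⟨i, hi⟩ := hmem x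
    obtain ⟨y, hy, hyK⟩ := mem_closure_iff.1 hx _ (hVo i) hi
    obtain ⟨k, hk⟩ := mem_iUnion.1 hyK
    exact mem_iUnion.2 ⟨k + 1, hKV k i ⟨y, hk, hy⟩ hi⟩
  have huniv : ⋃ k, K k = univ :=
    IsClopen.eq_univ ⟨hclosed, hopen⟩ ⟨x₀, mem_iUnion.2 ⟨0, mem_singleton x₀⟩⟩
  exact ⟨⟨K, hK, huniv⟩⟩

/-- The down-closure of a compact set for a closed relation is closed. -/
theorem isClosed_setOf_exists_rel_of_isCompact {R : Set (X × X)} (hR : IsClosed R) {C : Set X}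
    (hC : IsCompact C) : IsClosed {x | ∃ a ∈ C, (x, a) ∈ R} := by
  have : CompactSpace C := isCompact_iff_compactSpace.1 hC
  convert isClosedMap_fst_of_compactSpace (X := X) (Y := C) _
    (hR.preimage (continuous_fst.prodMk (continuous_subtype_val.comp continuous_snd))) using 1
  ext x
  simp

variable [LocallyCompactSpace X]

/-- Disjoint compact sets can be enlarged compatibly with a closed preorder. -/
theorem exists_compact_enlargement {R : Set (X × X)} (hR : IsClosed R) (hrefl : ∀ x, (x, x) ∈ R)
    (htrans : ∀ x y z, (x, y) ∈ R → (y, z) ∈ R → (x, z) ∈ R) {A B K : Set X}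
    (hK : IsCompact K) (hA : IsCompact A) (hB : IsCompact B)
    (hAB : ∀ a ∈ A, ∀ b ∈ B, (b, a) ∉ R) :
    ∃ A' B' : Set X, IsCompact A' ∧ IsCompact B' ∧ A' ⊆ K ∧ B' ⊆ K ∧
      (∀ a ∈ A', ∀ b ∈ B', (b, a) ∉ R) ∧
      (∃ U, IsOpen U ∧ A ⊆ U ∧ U ∩ K ⊆ A') ∧ (∃ U, IsOpen U ∧ B ⊆ U ∧ U ∩ K ⊆ B') ∧
      (∀ a ∈ A', ∀ x ∈ K, (x, a) ∈ R → x ∈ A') ∧ (∀ b ∈ B', ∀ x ∈ K, (b, x) ∈ R → x ∈ B') := by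
  -- The compact box `B ×ˢ A` lies in the open set `Rᶜ`, so a whole open box around it does.
  obtain ⟨U, V, hU, hV, hBU, hAV, hUV⟩ := generalized_tube_lemma hB hA hR.isOpen_compl
    (fun z hz ↦ hAB z.2 hz.2 z.1 hz.1)
  obtain ⟨C, hC, hAC, hCV⟩ := exists_compact_between hA hV hAV
  obtain ⟨D, hD, hBD, hDU⟩ := exists_compact_between hB hU hBU
  have hR' : IsClosed (Prod.swap ⁻¹' R) := hR.preimage continuous_swap
  -- The new sets are the down-closure of `C` and the up-closure of `D`, cut down to `K`. A relation
  -- from the second to the first would yield some `d ∈ D` below some `c ∈ C`.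
  refine ⟨{x | ∃ a ∈ C, (x, a) ∈ R} ∩ K, {x | ∃ a ∈ D, (x, a) ∈ Prod.swap ⁻¹' R} ∩ K,
    hK.inter_left (isClosed_setOf_exists_rel_of_isCompact hR hC),
    hK.inter_left (isClosed_setOf_exists_rel_of_isCompact hR' hD),
    inter_subset_right, inter_subset_right, ?_, ⟨interior C, isOpen_interior, hAC, ?_⟩,
    ⟨interior D, isOpen_interior, hBD, ?_⟩, ?_, ?_⟩
  · rintro a ⟨⟨c, hc, hac⟩, -⟩ b ⟨⟨d, hd, hdb⟩, -⟩ hba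
    exact hUV (mk_mem_prod (hDU hd) (hCV hc)) (htrans _ _ _ (htrans _ _ _ hdb hba) hac)
  · exact fun x hx ↦ ⟨⟨x, interior_subset hx.1, hrefl x⟩, hx.2⟩
  · exact fun x hx ↦ ⟨⟨x, interior_subset hx.1, hrefl x⟩, hx.2⟩
  · rintro a ⟨⟨c, hc, hac⟩, -⟩ x hx hxa
    exact ⟨⟨c, hc, htrans _ _ _ hxa hac⟩, hx⟩
  · rintro b ⟨⟨d, hd, hdb⟩, -⟩ x hx hbx
    exact ⟨⟨d, hd, htrans _ _ _ hdb hbx⟩, hx⟩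

/-- A closed preorder on a `σ`-compact locally compact Hausdorff space is normal: between a closed
down-set and an open down-set containing it, there are an open and a closed down-set. -/
theorem exists_open_closed_downset_between [T2Space X] [SigmaCompactSpace X] {R : Set (X × X)}
    (hR : IsClosed R) (hrefl : ∀ x, (x, x) ∈ R)
    (htrans : ∀ x y z, (x, y) ∈ R → (y, z) ∈ R → (x, z) ∈ R) {F W : Set X}
    (hF : IsClosed F) (hFd : ∀ x y, (x, y) ∈ R → y ∈ F → x ∈ F)
    (hW : IsOpen W) (hWd : ∀ x y, (x, y) ∈ R → y ∈ W → x ∈ W) (hFW : F ⊆ W) :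
    ∃ V D : Set X, IsOpen V ∧ (∀ x y, (x, y) ∈ R → y ∈ V → x ∈ V) ∧
      IsClosed D ∧ (∀ x y, (x, y) ∈ R → y ∈ D → x ∈ D) ∧ F ⊆ V ∧ V ⊆ D ∧ D ⊆ W := by
  let K : CompactExhaustion X := default
  let P : ℕ → Set X × Set X → Prop := fun k s ↦ IsCompact s.1 ∧ IsCompact s.2 ∧
    s.1 ⊆ K k ∧ s.2 ⊆ K k ∧ F ∩ K k ⊆ s.1 ∧ Wᶜ ∩ K k ⊆ s.2 ∧ ∀ a ∈ s.1, ∀ b ∈ s.2, (b, a) ∉ R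
  -- The neighbourhood clauses will make both unions open. The last two clauses, order-closedness
  -- inside `K (k + 1)`, will make them a down-set and an up-set.
  let Q : ℕ → Set X × Set X → Set X × Set X → Prop := fun k s s' ↦
    (∃ U, IsOpen U ∧ s.1 ⊆ U ∧ U ∩ K (k + 1) ⊆ s'.1) ∧
    (∃ U, IsOpen U ∧ s.2 ⊆ U ∧ U ∩ K (k + 1) ⊆ s'.2) ∧
    (∀ a ∈ s'.1, ∀ x ∈ K (k + 1), (x, a) ∈ R → x ∈ s'.1) ∧
    (∀ b ∈ s'.2, ∀ x ∈ K (k + 1), (b, x) ∈ R → x ∈ s'.2)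
  have step (k : ℕ) (s : Set X × Set X) (hs : P k s) : ∃ s', P (k + 1) s' ∧ Q k s s' := by
    obtain ⟨h1, h2, h3, h4, h5, h6, h7⟩ := hs
    obtain ⟨A', B', hA', hB', hAK, hBK, hAB, ⟨U, hU, hAU, hUA⟩, ⟨U', hU', hBU, hUB⟩, hd, hu⟩ :=
      exists_compact_enlargement hR hrefl htrans (K.isCompact (k + 1))
        (A := s.1 ∪ F ∩ K (k + 1)) (B := s.2 ∪ Wᶜ ∩ K (k + 1))
        (h1.union ((K.isCompact _).inter_left hF))
        (h2.union ((K.isCompact _).inter_left hW.isClosed_compl)) (by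
          -- In the mixed cases one point is forced into both `s.1` and `s.2`, which reflexivity
          -- forbids.
          rintro a (ha | ha) b (hb | hb) hba
          · exact h7 a ha b hb hba
          · exact h7 a ha a (h6 ⟨fun haW ↦ hb.1 (hWd _ _ hba haW), h3 ha⟩) (hrefl a)
          · exact h7 b (h5 ⟨hFd _ _ hba ha.1, h4 hb⟩) b hb (hrefl b)
          · exact hb.1 (hWd _ _ hba (hFW ha.1)))
    exact ⟨(A', B'), ⟨hA', hB', hAK, hBK,
      fun x hx ↦ hUA ⟨hAU (Or.inr hx), hx.2⟩, fun x hx ↦ hUB ⟨hBU (Or.inr hx), hx.2⟩, hAB⟩,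
      ⟨U, hU, subset_union_left.trans hAU, hUA⟩, ⟨U', hU', subset_union_left.trans hBU, hUB⟩,
      hd, hu⟩
  have start : P 0 (F ∩ K 0, Wᶜ ∩ K 0) :=
    ⟨(K.isCompact _).inter_left hF, (K.isCompact _).inter_left hW.isClosed_compl,
      inter_subset_right, inter_subset_right, subset_rfl, subset_rfl,
      fun a ha b hb hba ↦ hb.1 (hWd _ _ hba (hFW ha.1))⟩
  choose! f hfP hfQ using step
  let s : ℕ → Set X × Set X := fun k ↦ Nat.rec (F ∩ K 0, Wᶜ ∩ K 0) f k
  have hsP (k : ℕ) : P k (s k) := by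
    induction k with
    | zero => exact start
    | succ k ih => exact hfP k _ ih
  have hsQ (k : ℕ) : Q k (s k) (s (k + 1)) := hfQ k _ (hsP k)
  have hmono1 : Monotone fun k ↦ (s k).1 := monotone_nat_of_le_succ fun k x hx ↦ by
    obtain ⟨U, -, h, h'⟩ := (hsQ k).1
    exact h' ⟨h hx, K.subset_succ k ((hsP k).2.2.1 hx)⟩
  have hmono2 : Monotone fun k ↦ (s k).2 := monotone_nat_of_le_succ fun k x hx ↦ by
    obtain ⟨U, -, h, h'⟩ := (hsQ k).2.1
    exact h' ⟨h hx, K.subset_succ k ((hsP k).2.2.2.1 hx)⟩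
  -- The closed down-set is the complement of the open up-set grown around `Wᶜ`.
  refine ⟨⋃ k, (s k).1, (⋃ k, (s k).2)ᶜ, ?_, ?_, ?_, ?_, ?_, ?_, ?_⟩
  · refine isOpen_iff_mem_nhds.2 fun x hx ↦ ?_
    obtain ⟨k, hk⟩ := mem_iUnion.1 hx
    obtain ⟨U, hU, h, h'⟩ := (hsQ k).1
    filter_upwards [hU.mem_nhds (h hk), isOpen_interior.mem_nhds
      (K.subset_interior_succ k ((hsP k).2.2.1 hk))] with y hy hyK
    exact mem_iUnion.2 ⟨k + 1, h' ⟨hy, interior_subset hyK⟩⟩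
  · intro x y hxy hy
    obtain ⟨k, hk⟩ := mem_iUnion.1 hy
    obtain ⟨m, hm⟩ := K.exists_mem x
    -- `Q` gives order-closedness only at successor stages, hence the `+ 1`.
    refine mem_iUnion.2 ⟨max k m + 1, (hsQ _).2.2.1 y (hmono1 (show k ≤ max k m + 1 by omega) hk) x ?_ hxy⟩
    exact K.subset (show m ≤ max k m + 1 by omega) hm
  · refine (isOpen_iff_mem_nhds.2 fun x hx ↦ ?_).isClosed_compl
    obtain ⟨k, hk⟩ := mem_iUnion.1 hx
    obtain ⟨U, hU, h, h'⟩ := (hsQ k).2.1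
    filter_upwards [hU.mem_nhds (h hk), isOpen_interior.mem_nhds
      (K.subset_interior_succ k ((hsP k).2.2.2.1 hk))] with y hy hyK
    exact mem_iUnion.2 ⟨k + 1, h' ⟨hy, interior_subset hyK⟩⟩
  · intro x y hxy hy hx
    obtain ⟨k, hk⟩ := mem_iUnion.1 hx
    obtain ⟨m, hm⟩ := K.exists_mem y
    refine hy (mem_iUnion.2 ⟨max k m + 1, (hsQ _).2.2.2 x (hmono2 (show k ≤ max k m + 1 by omega) hk) y ?_ hxy⟩)
    exact K.subset (show m ≤ max k m + 1 by omega) hm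
  · intro x hx
    obtain ⟨m, hm⟩ := K.exists_mem x
    exact mem_iUnion.2 ⟨m, (hsP m).2.2.2.2.1 ⟨hx, hm⟩⟩
  · intro x hx hx'
    obtain ⟨k, hk⟩ := mem_iUnion.1 hx
    obtain ⟨m, hm⟩ := mem_iUnion.1 hx'
    exact (hsP (max k m)).2.2.2.2.2.2 x (hmono1 (le_max_left _ _) hk) x
      (hmono2 (le_max_right _ _) hm) (hrefl x)
  · intro x hx
    by_contra hxW
    obtain ⟨m, hm⟩ := K.exists_mem x
    exact hx (mem_iUnion.2 ⟨m, (hsP m).2.2.2.2.2.1 ⟨hxW, hm⟩⟩)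

/-- Points not related by a closed preorder are separated by a continuous isotone function. -/
theorem exists_continuous_isotone_separating [T2Space X] [SigmaCompactSpace X] {R : Set (X × X)}
    (hR : IsClosed R) (hrefl : ∀ x, (x, x) ∈ R)
    (htrans : ∀ x y z, (x, y) ∈ R → (y, z) ∈ R → (x, z) ∈ R) {x₀ y₀ : X} (h₀ : (x₀, y₀) ∉ R) :
    ∃ f : X → ℝ, Continuous f ∧ (∀ x, f x ∈ Icc (0 : ℝ) 1) ∧ (∀ x y, (x, y) ∈ R → f x ≤ f y) ∧
      f y₀ < f x₀ := by
  -- The closure of an open down-set need not be a down-set. `P` therefore asks only for a closed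
  -- down-set `d` squeezed between `c` and `u`, and this condition survives the Urysohn subdivision.
  let P : Set X → Set X → Prop := fun c u ↦ (∀ x y, (x, y) ∈ R → y ∈ u → x ∈ u) ∧
    ∃ d, IsClosed d ∧ (∀ x y, (x, y) ∈ R → y ∈ d → x ∈ d) ∧ c ⊆ d ∧ d ⊆ u
  let c : Urysohns.CU P :=
    { C := {x | (x, y₀) ∈ R}
      U := {x | (x₀, x) ∉ R}
      P_C_U := ⟨fun x y hxy hy hx ↦ hy (htrans _ _ _ hx hxy), {x | (x, y₀) ∈ R},
        hR.preimage (continuous_id.prodMk continuous_const),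
        fun x y hxy hy ↦ htrans _ _ _ hxy hy, subset_rfl, fun x hx hx' ↦ h₀ (htrans _ _ _ hx' hx)⟩
      closed_C := hR.preimage (continuous_id.prodMk continuous_const)
      open_U := hR.isOpen_compl.preimage (continuous_const.prodMk continuous_id)
      subset := fun x hx hx' ↦ h₀ (htrans _ _ _ hx' hx)
      hP := by
        rintro c u - ⟨hud, d, hd, hdd, hcd, hdu⟩ hu -
        obtain ⟨V, D, hV, hVd, hD, hDd, hdV, hVD, hDu⟩ :=
          exists_open_closed_downset_between hR hrefl htrans hd hdd hu hud hdu
        have hcl : closure V ⊆ D := closure_minimal hVD hD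
        exact ⟨V, hV, hcd.trans hdV, hcl.trans hDu, ⟨hVd, d, hd, hdd, hcd, hdV⟩,
          hud, D, hD, hDd, hcl, hDu⟩ }
  -- The zeroth approximation is the indicator of the complement of a down-set, and each later one
  -- is a midpoint of two isotone functions.
  have happrox (k : ℕ) : ∀ c : Urysohns.CU P, ∀ x y, (x, y) ∈ R →
      c.approx k x ≤ c.approx k y := by
    induction k with
    | zero =>
      intro c x y hxy
      by_cases hy : y ∈ c.U
      · rw [Urysohns.CU.approx, Urysohns.CU.approx,
          indicator_of_notMem (not_not.2 (c.P_C_U.1 x y hxy hy)), indicator_of_notMem (not_not.2 hy)]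
      · rw [c.approx_of_notMem_U 0 hy]
        exact c.approx_le_one 0 x
    | succ k ih =>
      intro c x y hxy
      simp only [Urysohns.CU.approx, midpoint_eq_smul_add, invOf_eq_inv, smul_eq_mul]
      have h1 := ih c.left x y hxy
      have h2 := ih c.right x y hxy
      linarith
  refine ⟨c.lim, c.continuous_lim, c.lim_mem_Icc, fun x y hxy ↦ ?_, ?_⟩
  · exact le_of_tendsto_of_tendsto' (c.tendsto_approx_atTop x) (c.tendsto_approx_atTop y)
      fun k ↦ happrox k c x y hxy
  · rw [c.lim_of_mem_C y₀ (hrefl y₀), c.lim_of_notMem_U x₀ (not_not.2 (hrefl x₀))]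
    exact zero_lt_one

/-- **Levin's theorem**: a closed preorder on a `σ`-compact, locally compact, second countable
Hausdorff space has a continuous utility. -/
theorem exists_continuous_isUtility [T2Space X] [SigmaCompactSpace X] [SecondCountableTopology X]
    {R : Set (X × X)} (hR : IsClosed R) (hrefl : ∀ x, (x, x) ∈ R)
    (htrans : ∀ x y z, (x, y) ∈ R → (y, z) ∈ R → (x, z) ∈ R) :
    ∃ u : X → ℝ, Continuous u ∧ IsUtility R u := by
  choose f hfc hf01 hfm hflt using fun z : (Rᶜ : Set (X × X)) ↦
    exists_continuous_isotone_separating hR hrefl htrans (x₀ := z.1.1) (y₀ := z.1.2) z.2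
  -- Each separating function works on an open set of pairs. These sets cover `Rᶜ`, and second
  -- countability of `X × X` leaves countably many.
  obtain ⟨T, hTc, hT⟩ := TopologicalSpace.isOpen_iUnion_countable
    (fun z : (Rᶜ : Set (X × X)) ↦ {w : X × X | f z w.2 < f z w.1})
    fun z ↦ isOpen_lt ((hfc z).comp continuous_snd) ((hfc z).comp continuous_fst)
  have hsep (x y : X) (h : (x, y) ∉ R) : ∃ z ∈ T, f z y < f z x := by
    have : (x, y) ∈ ⋃ z : (Rᶜ : Set (X × X)), {w : X × X | f z w.2 < f z w.1} :=
      mem_iUnion.2 ⟨⟨(x, y), h⟩, hflt ⟨(x, y), h⟩⟩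
    rw [← hT] at this
    simpa using this
  have : Countable T := hTc
  obtain ⟨e, he⟩ := exists_injective_nat T
  have hsum : Summable fun z : T ↦ (1 / 2 : ℝ) ^ e z :=
    summable_geometric_two.comp_injective he
  have hle (x : X) (z : T) : ‖(1 / 2 : ℝ) ^ e z * f z x‖ ≤ (1 / 2 : ℝ) ^ e z := by
    rw [Real.norm_of_nonneg (mul_nonneg (by positivity) (hf01 z x).1)]
    exact mul_le_of_le_one_right (by positivity) (hf01 z x).2
  have hsx (x : X) : Summable fun z : T ↦ (1 / 2 : ℝ) ^ e z * f z x :=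
    Summable.of_norm_bounded hsum (hle x)
  have hterm (x y : X) (hxy : (x, y) ∈ R) (z : T) :
      (1 / 2 : ℝ) ^ e z * f z x ≤ (1 / 2 : ℝ) ^ e z * f z y :=
    mul_le_mul_of_nonneg_left (hfm z x y hxy) (by positivity)
  refine ⟨fun x ↦ ∑' z : T, (1 / 2 : ℝ) ^ e z * f z x,
    continuous_tsum (fun z ↦ continuous_const.mul (hfc z)) hsum fun z x ↦ hle x z, ?_, ?_⟩
  · rintro x y ⟨hxy, hyx⟩
    exact le_antisymm ((hsx x).tsum_le_tsum (hterm x y hxy) (hsx y))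
      ((hsx y).tsum_le_tsum (hterm y x hyx) (hsx x))
  · rintro x y ⟨hxy, hnot⟩
    obtain ⟨z, hz, hlt⟩ := hsep y x fun hyx ↦ hnot ⟨hxy, hyx⟩
    exact Summable.tsum_lt_tsum (i := (⟨z, hz⟩ : T)) (hterm x y hxy)
      (mul_lt_mul_of_pos_left hlt (by positivity)) (hsx x) (hsx y)

end ClosedPreorder

/-! ### The metric, the time orientation and curve velocities in a chart. -/

namespace LorentzianTimeOriented

open Filter

variable {n : ℕ} {r : ℕ∞} {M : Type*} [TopologicalSpace M]
  [ChartedSpace (EuclideanSpace ℝ (Fin n)) M] [IsManifold (𝓡 n) 1 M]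
  (S : LorentzianTimeOriented n r M)

local notation "𝔼" n => EuclideanSpace ℝ (Fin n)

/-- The metric in the coordinates of the preferred chart at `x₀`. -/
noncomputable def chartMetric (x₀ : M) (y : 𝔼 n) : (𝔼 n) →L[ℝ] (𝔼 n) →L[ℝ] ℝ :=
  let A : (𝔼 n) →L[ℝ] TangentSpace (𝓡 n) ((extChartAt (𝓡 n) x₀).symm y) :=
    (trivializationAt (𝔼 n) (TangentSpace (𝓡 n)) x₀).symmL ℝ ((extChartAt (𝓡 n) x₀).symm y)
  (A.precomp ℝ).comp ((S.g ((extChartAt (𝓡 n) x₀).symm y)).comp A)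

/-- The covector `g(T, ·)` in the coordinates of the preferred chart at `x₀`. -/
noncomputable def chartTime (x₀ : M) (y : 𝔼 n) : (𝔼 n) →L[ℝ] ℝ :=
  let A : (𝔼 n) →L[ℝ] TangentSpace (𝓡 n) ((extChartAt (𝓡 n) x₀).symm y) :=
    (trivializationAt (𝔼 n) (TangentSpace (𝓡 n)) x₀).symmL ℝ ((extChartAt (𝓡 n) x₀).symm y)
  (S.g ((extChartAt (𝓡 n) x₀).symm y) (S.T ((extChartAt (𝓡 n) x₀).symm y))).comp A

theorem chartMetric_symm (x₀ : M) (y v w : 𝔼 n) :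
    S.chartMetric x₀ y v w = S.chartMetric x₀ y w v :=
  S.symm _ _ _

/-- The derivative of the chart is the tangent bundle trivialization over it, so `symmL` undoes it.
This carries the cone conditions between manifold and chart. -/
theorem symmL_mfderiv_extChartAt {x₀ x : M} (hx : x ∈ (extChartAt (𝓡 n) x₀).source)
    (v : TangentSpace (𝓡 n) x) :
    (trivializationAt (𝔼 n) (TangentSpace (𝓡 n)) x₀).symmL ℝ x
      (mfderiv (𝓡 n) 𝓘(ℝ, 𝔼 n) (extChartAt (𝓡 n) x₀) x v) = v := by
  rw [extChartAt_source] at hx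
  rw [← TangentBundle.continuousLinearMapAt_trivializationAt hx]
  exact Trivialization.symmL_continuousLinearMapAt _ (by simpa using hx) v

theorem chartMetric_mfderiv {x₀ x : M} (hx : x ∈ (extChartAt (𝓡 n) x₀).source)
    (v w : TangentSpace (𝓡 n) x) :
    S.chartMetric x₀ (extChartAt (𝓡 n) x₀ x)
      (mfderiv (𝓡 n) 𝓘(ℝ, 𝔼 n) (extChartAt (𝓡 n) x₀) x v)
      (mfderiv (𝓡 n) 𝓘(ℝ, 𝔼 n) (extChartAt (𝓡 n) x₀) x w) = S.g x v w := by
  -- The base point `(extChartAt (𝓡 n) x₀).symm (extChartAt (𝓡 n) x₀ x)` is only propositionally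
  -- `x`; generalizing it avoids a transport between tangent spaces.
  have key : ∀ x' : M, x' = x →
      S.g x' ((trivializationAt (𝔼 n) (TangentSpace (𝓡 n)) x₀).symmL ℝ x'
        (mfderiv (𝓡 n) 𝓘(ℝ, 𝔼 n) (extChartAt (𝓡 n) x₀) x v))
        ((trivializationAt (𝔼 n) (TangentSpace (𝓡 n)) x₀).symmL ℝ x'
        (mfderiv (𝓡 n) 𝓘(ℝ, 𝔼 n) (extChartAt (𝓡 n) x₀) x w)) = S.g x v w := by
    rintro x' rfl
    rw [symmL_mfderiv_extChartAt hx, symmL_mfderiv_extChartAt hx]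
  exact key _ ((extChartAt (𝓡 n) x₀).left_inv hx)

theorem chartTime_mfderiv {x₀ x : M} (hx : x ∈ (extChartAt (𝓡 n) x₀).source)
    (v : TangentSpace (𝓡 n) x) :
    S.chartTime x₀ (extChartAt (𝓡 n) x₀ x)
      (mfderiv (𝓡 n) 𝓘(ℝ, 𝔼 n) (extChartAt (𝓡 n) x₀) x v) = S.g x (S.T x) v := by
  have key : ∀ x' : M, x' = x →
      S.g x' (S.T x') ((trivializationAt (𝔼 n) (TangentSpace (𝓡 n)) x₀).symmL ℝ x'
        (mfderiv (𝓡 n) 𝓘(ℝ, 𝔼 n) (extChartAt (𝓡 n) x₀) x v)) = S.g x (S.T x) v := by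
    rintro x' rfl
    rw [symmL_mfderiv_extChartAt hx]
  exact key _ ((extChartAt (𝓡 n) x₀).left_inv hx)

theorem contMDiffOn_symmL_apply [IsManifold (𝓡 n) 2 M] (x₀ : M) (v : 𝔼 n) :
    ContMDiffOn (𝓡 n) ((𝓡 n).prod 𝓘(ℝ, 𝔼 n)) 1
      (fun x : M ↦ TotalSpace.mk' (𝔼 n) (E := (TangentSpace (𝓡 n) : M → Type _)) x
        ((trivializationAt (𝔼 n) (TangentSpace (𝓡 n)) x₀).symmL ℝ x v))
      (extChartAt (𝓡 n) x₀).source := by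
  have hb : (extChartAt (𝓡 n) x₀).source =
      (trivializationAt (𝔼 n) (TangentSpace (𝓡 n) : M → Type _) x₀).baseSet := by simp
  rw [hb, Trivialization.contMDiffOn_section_baseSet_iff]
  refine contMDiffOn_const (c := v) |>.congr fun x hx ↦ ?_
  simp only [Trivialization.symmL_apply _ hx, Trivialization.apply_mk_symm _ hx]

/-- The entries are `g` on pairs of sections with constant coordinates. Class $C^1$ supplies the
local Lipschitz bound used by the perturbation. -/
theorem contDiffOn_chartMetric [IsManifold (𝓡 n) 2 M] (hr : 2 ≤ r) (x₀ : M) :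
    ContDiffOn ℝ 1 (S.chartMetric x₀) (extChartAt (𝓡 n) x₀).target := by
  rw [contDiffOn_clm_apply]
  intro v
  rw [contDiffOn_clm_apply]
  intro w
  rw [← contMDiffOn_iff_contDiffOn]
  have h1 : (1 : ℕ∞ω) ≤ ((r - 1 : ℕ∞) : ℕ∞ω) := by
    have : (1 : ℕ∞) ≤ r - 1 := ENat.le_sub_of_add_le_left (by simp) (by simpa [one_add_one_eq_two])
    exact_mod_cast this
  have hg := S.contMDiff_g.of_le h1
  have h := (hg.contMDiffOn (s := (extChartAt (𝓡 n) x₀).source)).clm_bundle_apply₂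
    (F₁ := 𝔼 n) (F₂ := 𝔼 n) (F₃ := ℝ) (E₃ := Bundle.Trivial M ℝ)
    (contMDiffOn_symmL_apply x₀ v) (contMDiffOn_symmL_apply x₀ w)
  have h' : ContMDiffOn (𝓡 n) 𝓘(ℝ, ℝ) 1 (fun x : M ↦ S.g x
      ((trivializationAt (𝔼 n) (TangentSpace (𝓡 n)) x₀).symmL ℝ x v)
      ((trivializationAt (𝔼 n) (TangentSpace (𝓡 n)) x₀).symmL ℝ x w))
      (extChartAt (𝓡 n) x₀).source := by
    intro x hx
    have := h x hx
    simp only [contMDiffWithinAt_totalSpace] at this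
    exact this.2
  exact h'.comp (contMDiffOn_extChartAt_symm x₀) (extChartAt (𝓡 n) x₀).mapsTo_symm

theorem continuousOn_chartTime [IsManifold (𝓡 n) 2 M] (x₀ : M) :
    ContinuousOn (S.chartTime x₀) (extChartAt (𝓡 n) x₀).target := by
  rw [continuousOn_clm_apply]
  intro v
  have h := (S.contMDiff_g.continuous.continuousOn
    (s := (extChartAt (𝓡 n) x₀).source)).clm_bundle_apply₂
    (F₁ := 𝔼 n) (F₂ := 𝔼 n) (F₃ := ℝ) (E₃ := Bundle.Trivial M ℝ)
    (v := S.T) S.continuous_T.continuousOn (contMDiffOn_symmL_apply x₀ v).continuousOn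
  have h' : ContinuousOn (fun x : M ↦ S.g x (S.T x)
      ((trivializationAt (𝔼 n) (TangentSpace (𝓡 n)) x₀).symmL ℝ x v))
      (extChartAt (𝓡 n) x₀).source := by
    intro x hx
    have := h x hx
    simp only [FiberBundle.continuousWithinAt_totalSpace] at this
    exact this.2
  exact h'.comp (continuousOn_extChartAt_symm x₀) (extChartAt (𝓡 n) x₀).mapsTo_symm

/-- The future timelike vectors in the coordinates of the preferred chart at `x₀`. -/
def chartCone (x₀ : M) : Set ((𝔼 n) × (𝔼 n)) :=
  {z | z.1 ∈ (extChartAt (𝓡 n) x₀).target ∧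
    S.chartMetric x₀ z.1 z.2 z.2 < 0 ∧ S.chartTime x₀ z.1 z.2 < 0}

theorem isOpen_chartCone [IsManifold (𝓡 n) 2 M] (hr : 2 ≤ r) (x₀ : M) :
    IsOpen (S.chartCone x₀) := by
  have ho : IsOpen ((extChartAt (𝓡 n) x₀).target ×ˢ (univ : Set (𝔼 n))) :=
    (isOpen_extChartAt_target x₀).prod isOpen_univ
  have hm : MapsTo Prod.fst ((extChartAt (𝓡 n) x₀).target ×ˢ (univ : Set (𝔼 n)))
    (extChartAt (𝓡 n) x₀).target := fun z hz ↦ hz.1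
  have hG : ContinuousOn (fun z : (𝔼 n) × (𝔼 n) ↦ S.chartMetric x₀ z.1 z.2 z.2)
      ((extChartAt (𝓡 n) x₀).target ×ˢ (univ : Set (𝔼 n))) :=
    (((S.contDiffOn_chartMetric hr x₀).continuousOn.comp continuousOn_fst hm).clm_apply
      continuousOn_snd).clm_apply continuousOn_snd
  have hT : ContinuousOn (fun z : (𝔼 n) × (𝔼 n) ↦ S.chartTime x₀ z.1 z.2)
      ((extChartAt (𝓡 n) x₀).target ×ˢ (univ : Set (𝔼 n))) :=
    ((S.continuousOn_chartTime x₀).comp continuousOn_fst hm).clm_apply continuousOn_snd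
  have := (hG.isOpen_inter_preimage ho (isOpen_Iio (a := 0))).inter
    (hT.isOpen_inter_preimage ho (isOpen_Iio (a := 0)))
  convert this using 1
  ext z
  simp [chartCone]
  tauto

/-- The chart expression of a differentiable curve has the velocity read in the chart as its
derivative. -/
theorem hasDerivWithinAt_extChartAt_comp {γ : ℝ → M} {a b t : ℝ}
    (hγ : ContMDiffOn 𝓘(ℝ, ℝ) (𝓡 n) 1 γ (Icc a b)) (ht : t ∈ Icc a b) {x₀ : M}
    (hx : γ t ∈ (extChartAt (𝓡 n) x₀).source) :
    HasDerivWithinAt (fun s ↦ extChartAt (𝓡 n) x₀ (γ s))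
      (mfderiv (𝓡 n) 𝓘(ℝ, 𝔼 n) (extChartAt (𝓡 n) x₀) (γ t) (velocity n γ a b t)) (Icc a b) t := by
  have h1 := ((hγ t ht).mdifferentiableWithinAt one_ne_zero).hasMFDerivWithinAt
  have h2 : HasMFDerivAt (𝓡 n) 𝓘(ℝ, 𝔼 n) (extChartAt (𝓡 n) x₀) (γ t)
      (mfderiv (𝓡 n) 𝓘(ℝ, 𝔼 n) (extChartAt (𝓡 n) x₀) (γ t)) :=
    (mdifferentiableAt_extChartAt (by simpa using hx)).hasMFDerivAt
  have h3 := (h2.comp_hasMFDerivWithinAt t h1)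
  let L : ℝ →L[ℝ] 𝔼 n := (mfderiv (𝓡 n) 𝓘(ℝ, 𝔼 n) (extChartAt (𝓡 n) x₀) (γ t)).comp
    (mfderivWithin 𝓘(ℝ, ℝ) (𝓡 n) γ (Icc a b) t)
  have h4 : HasFDerivWithinAt (fun s ↦ extChartAt (𝓡 n) x₀ (γ s)) L (Icc a b) t :=
    hasMFDerivWithinAt_iff_hasFDerivWithinAt.1 h3
  exact h4.hasDerivWithinAt

/-- A curve in a chart with velocities in the coordinate cone gives a timelike segment. -/
theorem timelikeSegment_of_chart {x₀ : M} {c v : ℝ → 𝔼 n} {a b : ℝ} (hab : a < b)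
    (hc : ContDiffOn ℝ 1 c (Icc a b))
    (hv : ∀ t ∈ Icc a b, HasDerivWithinAt c (v t) (Icc a b) t)
    (hcone : ∀ t ∈ Icc a b, (c t, v t) ∈ S.chartCone x₀) :
    S.TimelikeSegment ((extChartAt (𝓡 n) x₀).symm (c a)) ((extChartAt (𝓡 n) x₀).symm (c b)) := by
  have hγ : ContMDiffOn 𝓘(ℝ, ℝ) (𝓡 n) 1 (fun t ↦ (extChartAt (𝓡 n) x₀).symm (c t)) (Icc a b) :=
    (contMDiffOn_extChartAt_symm x₀).comp hc.contMDiffOn fun t ht ↦ (hcone t ht).1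
  refine ⟨fun t ↦ (extChartAt (𝓡 n) x₀).symm (c t), a, b, hab, rfl, rfl, hγ, fun t ht ↦ ?_⟩
  have hx : (extChartAt (𝓡 n) x₀).symm (c t) ∈ (extChartAt (𝓡 n) x₀).source :=
    (extChartAt (𝓡 n) x₀).map_target (hcone t ht).1
  have h1 := hasDerivWithinAt_extChartAt_comp hγ ht hx
  have h2 : HasDerivWithinAt c (mfderiv (𝓡 n) 𝓘(ℝ, 𝔼 n) (extChartAt (𝓡 n) x₀)
      ((extChartAt (𝓡 n) x₀).symm (c t))
      (velocity n (fun t ↦ (extChartAt (𝓡 n) x₀).symm (c t)) a b t)) (Icc a b) t :=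
    h1.congr (fun s hs ↦ ((extChartAt (𝓡 n) x₀).right_inv (hcone s hs).1).symm)
      ((extChartAt (𝓡 n) x₀).right_inv (hcone t ht).1).symm
  have h3 := (uniqueDiffOn_Icc hab t ht).eq_deriv _ h2 (hv t ht)
  have h4 := (hcone t ht).2
  simp only [← h3] at h4
  constructor
  · rw [← S.chartMetric_mfderiv hx, (extChartAt (𝓡 n) x₀).right_inv (hcone t ht).1]
    exact h4.1
  · rw [← S.chartTime_mfderiv hx, (extChartAt (𝓡 n) x₀).right_inv (hcone t ht).1]
    exact h4.2

omit [IsManifold (𝓡 n) 1 M] in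
theorem velocity_eq_of_subset {γ : ℝ → M} {a b a' b' t : ℝ}
    (hγ : ContMDiffOn 𝓘(ℝ, ℝ) (𝓡 n) 1 γ (Icc a b)) (ha : a ≤ a') (hb : b' ≤ b) (hab : a' < b')
    (ht : t ∈ Icc a' b') : velocity n γ a' b' t = velocity n γ a b t := by
  have hsub : Icc a' b' ⊆ Icc a b := Icc_subset_Icc ha hb
  unfold velocity
  rw [mfderivWithin_subset hsub ((uniqueDiffOn_Icc hab t ht).uniqueMDiffWithinAt)
    ((hγ t (hsub ht)).mdifferentiableWithinAt one_ne_zero)]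

end LorentzianTimeOriented

/-! ### Perturbation of curves in a normed space. -/

section Perturbation

open Filter

variable {E : Type*} [NormedAddCommGroup E] [NormedSpace ℝ E]

/-- Near a point of a differentiable curve with velocity in an open set of directions, straight
lines from the curve to points near the base point have directions in this set. -/
theorem HasDerivWithinAt.eventually_line_mem {C : Set (E × E)} (hC : IsOpen C) {c : ℝ → E} {v : E}
    {s : Set ℝ} {t₀ : ℝ} (hc : HasDerivWithinAt c v s t₀) (hv : (c t₀, v) ∈ C) :
    ∀ᶠ t in 𝓝[s \ {t₀}] t₀, ∀ᶠ y in 𝓝 (c t₀), ∃ w, y - c t = (t₀ - t) • w ∧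
      ∀ θ ∈ Icc (0 : ℝ) 1, (c t + θ • (y - c t), w) ∈ C := by
  obtain ⟨ε, hε, hball⟩ := Metric.isOpen_iff.1 hC _ hv
  have h1 : ∀ᶠ t in 𝓝[s \ {t₀}] t₀, slope c t₀ t ∈ Metric.ball v ε :=
    (hasDerivWithinAt_iff_tendsto_slope.1 hc).eventually (Metric.ball_mem_nhds v hε)
  have h2 : ∀ᶠ t in 𝓝[s \ {t₀}] t₀, c t ∈ Metric.ball (c t₀) ε :=
    (hc.continuousWithinAt.mono sdiff_subset).eventually (Metric.ball_mem_nhds _ hε)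
  filter_upwards [h1, h2, self_mem_nhdsWithin] with t ht1 ht2 ht3
  have hne : t₀ - t ≠ 0 := sub_ne_zero.2 (Ne.symm ht3.2)
  have hcont : Continuous fun y ↦ (t₀ - t)⁻¹ • (y - c t) := by fun_prop
  -- At `y = c t₀` the direction is the difference quotient, close to `v` on both sides of `t₀`;
  -- with `t` fixed, continuity in `y` does the rest.
  have hval : (t₀ - t)⁻¹ • (c t₀ - c t) ∈ Metric.ball v ε := by
    rwa [slope_comm] at ht1
  filter_upwards [hcont.continuousAt.eventually (Metric.isOpen_ball.mem_nhds hval),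
    Metric.ball_mem_nhds _ hε] with y hy1 hy2
  refine ⟨(t₀ - t)⁻¹ • (y - c t), by rw [smul_inv_smul₀ hne], fun θ hθ ↦ hball ?_⟩
  rw [← ball_prod_same]
  exact ⟨(convex_ball (c t₀) ε).add_smul_sub_mem ht2 hy2 hθ, hy1⟩

theorem ContDiffAt.exists_norm_sub_le {F : Type*} [NormedAddCommGroup F] [NormedSpace ℝ F]
    {f : E → F} {x : E} (hf : ContDiffAt ℝ 1 f x) :
    ∃ L : NNReal, ∃ W ∈ 𝓝 x, ∀ y ∈ W, ∀ z ∈ W, ‖f y - f z‖ ≤ L * ‖y - z‖ := by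
  obtain ⟨L, W, hW, hL⟩ := hf.exists_lipschitzOnWith
  exact ⟨L, W, hW, fun y hy z hz ↦ hL.norm_sub_le hy hz⟩

/-- A curve which is causal for a `C¹` field of bilinear forms can be perturbed, keeping its end
point and moving the starting point as little as desired, to a timelike curve. -/
theorem exists_timelike_perturbation {G : E → E →L[ℝ] E →L[ℝ] ℝ} {τ : E → E →L[ℝ] ℝ} {Ω : Set E}
    (hΩ : IsOpen Ω) (hG : ContDiffOn ℝ 1 G Ω) (hτ : ContinuousOn τ Ω)
    (hsymm : ∀ y v w, G y v w = G y w v) {c v : ℝ → E} {a b : ℝ} (hab : a < b)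
    (hc : ContDiffOn ℝ 1 c (Icc a b)) (hcv : ∀ t ∈ Icc a b, HasDerivWithinAt c (v t) (Icc a b) t)
    (hb : c b ∈ Ω) (hcausal : ∀ t ∈ Icc a b, G (c t) (v t) (v t) ≤ 0) {e : E}
    (hee : G (c b) e e < 0) (hev : G (c b) e (v b) < 0) (hτv : τ (c b) (v b) < 0)
    (hτe : τ (c b) e < 0) :
    ∃ s ∈ Ico a b, ∀ U ∈ 𝓝 (c s), ∃ c' v' : ℝ → E, c' s ∈ U ∧ c' b = c b ∧
      ContDiffOn ℝ 1 c' (Icc s b) ∧ (∀ t ∈ Icc s b, HasDerivWithinAt c' (v' t) (Icc s b) t) ∧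
      ∀ t ∈ Icc s b, c' t ∈ Ω ∧ G (c' t) (v' t) (v' t) < 0 ∧ τ (c' t) (v' t) < 0 := by
  have hΩb : Ω ∈ 𝓝 (c b) := hΩ.mem_nhds hb
  obtain ⟨L, W, hW, hL⟩ := (hG.contDiffAt hΩb).exists_norm_sub_le
  have hGc : ContinuousAt G (c b) := (hG.contDiffAt hΩb).continuousAt
  have hτc : ContinuousAt τ (c b) := hτ.continuousAt hΩb
  obtain ⟨κ, hκ, hκe⟩ : ∃ κ > 0, G (c b) e (v b) < -κ :=
    ⟨-G (c b) e (v b) / 2, by linarith, by linarith⟩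
  have hfst : ContinuousAt (fun z : E × E ↦ G z.1) (c b, v b) :=
    ContinuousAt.comp (f := Prod.fst) (x := (c b, v b)) hGc continuousAt_fst
  have hfst' : ContinuousAt (fun z : E × E ↦ τ z.1) (c b, v b) :=
    ContinuousAt.comp (f := Prod.fst) (x := (c b, v b)) hτc continuousAt_fst
  have hnear : ∀ᶠ z : E × E in 𝓝 (c b, v b), (z.1 ∈ Ω ∧ z.1 ∈ W) ∧ G z.1 e e < 0 ∧ τ z.1 e < 0 ∧
      G z.1 e z.2 < -κ ∧ τ z.1 z.2 < 0 ∧ ‖z.2‖ < ‖v b‖ + 1 := by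
    have hΩW : ∀ᶠ z : E × E in 𝓝 (c b, v b), z.1 ∈ Ω ∧ z.1 ∈ W :=
      continuousAt_fst.eventually (inter_mem hΩb hW)
    have he1 : ContinuousAt (fun z : E × E ↦ G z.1 e e) (c b, v b) :=
      (hfst.clm_apply continuousAt_const).clm_apply continuousAt_const
    have he2 : ContinuousAt (fun z : E × E ↦ τ z.1 e) (c b, v b) :=
      hfst'.clm_apply continuousAt_const
    have he3 : ContinuousAt (fun z : E × E ↦ G z.1 e z.2) (c b, v b) :=
      (hfst.clm_apply continuousAt_const).clm_apply continuousAt_snd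
    have he4 : ContinuousAt (fun z : E × E ↦ τ z.1 z.2) (c b, v b) :=
      hfst'.clm_apply continuousAt_snd
    have he5 : ContinuousAt (fun z : E × E ↦ ‖z.2‖) (c b, v b) := continuousAt_snd.norm
    exact hΩW.and ((he1.eventually_lt_const hee).and ((he2.eventually_lt_const hτe).and
      ((he3.eventually_lt_const hκe).and ((he4.eventually_lt_const hτv).and
        (he5.eventually_lt_const (lt_add_one _))))))
  obtain ⟨ε, hε, hball⟩ := Metric.eventually_nhds_iff_ball.1 hnear
  have hball' : ∀ y w : E, dist y (c b) < ε → dist w (v b) < ε → (y ∈ Ω ∧ y ∈ W) ∧ G y e e < 0 ∧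
      τ y e < 0 ∧ G y e w < -κ ∧ τ y w < 0 ∧ ‖w‖ < ‖v b‖ + 1 := fun y w hy hw ↦
    hball (y, w) (by rw [← ball_prod_same]; exact ⟨hy, hw⟩)
  have hbI : b ∈ Icc a b := right_mem_Icc.2 hab.le
  have hvc : ContinuousOn v (Icc a b) :=
    (hc.continuousOn_derivWithin (uniqueDiffOn_Icc hab) le_rfl).congr fun t ht ↦
      ((hcv t ht).derivWithin (uniqueDiffOn_Icc hab t ht)).symm
  have hev1 : ∀ᶠ t in 𝓝[Icc a b] b, dist (c t) (c b) < ε / 2 ∧ dist (v t) (v b) < ε :=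
    ((hc.continuousOn b hbI).eventually (Metric.ball_mem_nhds _ (half_pos hε))).and
      ((hvc b hbI).eventually (Metric.ball_mem_nhds _ hε))
  obtain ⟨η, hη, hηs⟩ := Metric.mem_nhdsWithin_iff.1 hev1
  obtain ⟨s, hs1, hs2⟩ := exists_between (max_lt hab (sub_lt_self b hη))
  have has : a < s := (le_max_left _ _).trans_lt hs1
  have hsub : Icc s b ⊆ Icc a b := Icc_subset_Icc has.le le_rfl
  have hclose (t : ℝ) (ht : t ∈ Icc s b) : dist (c t) (c b) < ε / 2 ∧ dist (v t) (v b) < ε := by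
    refine hηs ⟨?_, hsub ht⟩
    have := (le_max_right a (b - η)).trans_lt hs1
    rw [Metric.mem_ball, Real.dist_eq, abs_sub_lt_iff]
    constructor <;> linarith [ht.1, ht.2]
  -- The parameter `s` is fixed before `U`; only the amplitude `δ` below depends on `U`.
  refine ⟨s, ⟨has.le, hs2⟩, fun U hU ↦ ?_⟩
  set V := ‖v b‖ + 1 with hV
  have hVpos : 0 < V := by positivity
  obtain ⟨K, hK, hKκ⟩ : ∃ K > 0, L * ‖e‖ * V ^ 2 ≤ κ * K :=
    ⟨(L * ‖e‖ * V ^ 2 + 1) / κ, by positivity, by rw [mul_div_cancel₀ _ hκ.ne']; linarith⟩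
  -- The displacement `f δ t • e` vanishes at `b`, and its rate `h` satisfies `K * |f| ≤ h`. Moving
  -- the base point changes `G v v` by at most `L * ‖e‖ * V ^ 2 * |f| ≤ κ * h`, whereas the added
  -- velocity `h • e` contributes the cross term `2 * h * G e v < -2 * κ * h`, which wins.
  let f : ℝ → ℝ → ℝ := fun δ t ↦ δ * (1 - Real.exp (K * (b - t)))
  have hf0 : Tendsto (fun δ ↦ f δ s) (𝓝[>] 0) (𝓝 0) := by
    have : Continuous fun δ ↦ f δ s := by fun_prop
    simpa [f] using (this.tendsto 0).mono_left nhdsWithin_le_nhds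
  have hf1 : ∀ᶠ δ in 𝓝[>] (0 : ℝ), c s + f δ s • e ∈ U := by
    have : Tendsto (fun δ ↦ c s + f δ s • e) (𝓝[>] 0) (𝓝 (c s)) := by
      simpa using (hf0.smul_const e).const_add (c s)
    exact this hU
  have hf2 : ∀ᶠ δ in 𝓝[>] (0 : ℝ), ‖f δ s • e‖ < ε / 2 := by
    have : Tendsto (fun δ ↦ ‖f δ s • e‖) (𝓝[>] 0) (𝓝 0) := by
      simpa using (hf0.smul_const e).norm
    exact this.eventually_lt_const (half_pos hε)
  obtain ⟨δ, ⟨hδU, hδε⟩, hδ⟩ := ((hf1.and hf2).and self_mem_nhdsWithin).exists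
  let h : ℝ → ℝ := fun t ↦ δ * (K * Real.exp (K * (b - t)))
  have hfd (t : ℝ) : HasDerivAt (f δ) (h t) t := by
    have h1 : HasDerivAt (fun t ↦ K * (b - t)) (-K) t := by
      simpa using ((hasDerivAt_id t).const_sub b).const_mul K
    have h2 := (h1.exp.const_sub 1).const_mul δ
    exact h2.congr_deriv (by simp only [h]; ring)
  have hfC : ContDiff ℝ 1 (f δ) := by fun_prop
  refine ⟨fun t ↦ c t + f δ t • e, fun t ↦ v t + h t • e, hδU, by simp [f],
    (hc.mono hsub).add (hfC.contDiffOn.smul contDiffOn_const),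
    fun t ht ↦ ((hcv t (hsub ht)).mono hsub).add ((hfd t).hasDerivWithinAt.smul_const e),
    fun t ht ↦ ?_⟩
  have hexp : 1 ≤ Real.exp (K * (b - t)) :=
    Real.one_le_exp (mul_nonneg hK.le (sub_nonneg.2 ht.2))
  have hexp' : Real.exp (K * (b - t)) ≤ Real.exp (K * (b - s)) := by
    gcongr
    exact ht.1
  have habs (t : ℝ) (ht : t ≤ b) : |f δ t| = δ * (Real.exp (K * (b - t)) - 1) := by
    have : 1 ≤ Real.exp (K * (b - t)) :=
      Real.one_le_exp (mul_nonneg hK.le (sub_nonneg.2 ht))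
    simp only [f]
    rw [abs_mul, abs_of_pos hδ, abs_sub_comm, abs_of_nonneg (sub_nonneg.2 this)]
  have hht : 0 < h t := by positivity
  have hfh : K * |f δ t| ≤ h t := by
    rw [habs t ht.2]
    simp only [h]
    nlinarith [mul_pos hδ hK]
  have hfs : |f δ t| ≤ |f δ s| := by
    rw [habs t ht.2, habs s hs2.le]
    gcongr
  obtain ⟨hct, hvt⟩ := hclose t ht
  have hdist : dist (c t + f δ t • e) (c b) < ε := by
    have h1 : dist (c t + f δ t • e) (c t) ≤ ‖f δ s • e‖ := by
      rw [dist_eq_norm, add_sub_cancel_left, norm_smul, norm_smul, Real.norm_eq_abs,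
        Real.norm_eq_abs]
      gcongr
    linarith [dist_triangle (c t + f δ t • e) (c t) (c b)]
  obtain ⟨⟨hyΩ, hyW⟩, hyee, hyτ, hyev, hyτv, hvV⟩ := hball' _ _ hdist hvt
  have hcW := (hball' (c t) (v t) (by linarith) hvt).1.2
  refine ⟨hyΩ, ?_, ?_⟩
  · have hlip : ‖G (c t + f δ t • e) - G (c t)‖ ≤ L * (|f δ t| * ‖e‖) := by
      have := hL _ hyW _ hcW
      rwa [add_sub_cancel_left, norm_smul, Real.norm_eq_abs] at this
    have hdiff : G (c t + f δ t • e) (v t) (v t) - G (c t) (v t) (v t) ≤ κ * h t := by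
      calc G (c t + f δ t • e) (v t) (v t) - G (c t) (v t) (v t)
          = (G (c t + f δ t • e) - G (c t)) (v t) (v t) := rfl
        _ ≤ ‖(G (c t + f δ t • e) - G (c t)) (v t) (v t)‖ := Real.le_norm_self _
        _ ≤ ‖G (c t + f δ t • e) - G (c t)‖ * ‖v t‖ * ‖v t‖ :=
          ContinuousLinearMap.le_opNorm₂ _ _ _
        _ ≤ L * (|f δ t| * ‖e‖) * V * V := by gcongr
        _ = (L * ‖e‖ * V ^ 2) * |f δ t| := by ring
        _ ≤ κ * K * |f δ t| := by gcongr
        _ = κ * (K * |f δ t|) := by ring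
        _ ≤ κ * h t := by gcongr
    have hexpand : G (c t + f δ t • e) (v t + h t • e) (v t + h t • e) =
        G (c t + f δ t • e) (v t) (v t) + 2 * (h t * G (c t + f δ t • e) e (v t)) +
          h t ^ 2 * G (c t + f δ t • e) e e := by
      simp only [map_add, map_smul, add_apply, smul_apply,
        smul_eq_mul, hsymm _ (v t) e]
      ring
    have h1 := hcausal t (hsub ht)
    have h2 : h t * G (c t + f δ t • e) e (v t) < h t * -κ := mul_lt_mul_of_pos_left hyev hht
    have h3 : h t ^ 2 * G (c t + f δ t • e) e e ≤ 0 :=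
      mul_nonpos_of_nonneg_of_nonpos (by positivity) hyee.le
    have h4 : 0 < κ * h t := mul_pos hκ hht
    simp only [hexpand]
    linarith
  · simp only [map_add, map_smul, smul_eq_mul]
    linarith [mul_neg_of_pos_of_neg hht hyτ]

end Perturbation

/-! ### Openness of $I^+$, the push-up property, and its consequence for $\overline{J^+}$. -/

namespace LorentzianTimeOriented

open Filter

variable {n : ℕ} {r : ℕ∞} {M : Type*} [TopologicalSpace M]
  [ChartedSpace (EuclideanSpace ℝ (Fin n)) M] [IsManifold (𝓡 n) 1 M]
  (S : LorentzianTimeOriented n r M)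

local notation "𝔼" n => EuclideanSpace ℝ (Fin n)

/-- A straight line in a chart with direction in the coordinate cone is a timelike segment. -/
theorem timelikeSegment_of_line {x₀ : M} {x y w : 𝔼 n} {l : ℝ} (hl : 0 < l) (hxy : y - x = l • w)
    (hcone : ∀ θ ∈ Icc (0 : ℝ) 1, (x + θ • (y - x), w) ∈ S.chartCone x₀) :
    S.TimelikeSegment ((extChartAt (𝓡 n) x₀).symm x) ((extChartAt (𝓡 n) x₀).symm y) := by
  have h := S.timelikeSegment_of_chart (x₀ := x₀) (c := fun t ↦ x + t • w) (v := fun _ ↦ w) hl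
    (by fun_prop)
    (fun t _ ↦ by
      simpa using (((hasDerivAt_id t).smul_const w).const_add x).hasDerivWithinAt)
    (fun t ht ↦ by
      have := hcone (t / l) ⟨div_nonneg ht.1 hl.le, (div_le_one hl).2 ht.2⟩
      rwa [hxy, smul_smul, div_mul_cancel₀ _ hl.ne'] at this)
  simpa [← hxy] using h

/-- Near a point of a timelike curve, points of the curve and points near the given one are joined
by timelike lines in a chart. -/
theorem eventually_timelikeSegment_of_curve [IsManifold (𝓡 n) 2 M] (hr : 2 ≤ r) {γ : ℝ → M}
    {a b t₀ : ℝ} (hγ : ContMDiffOn 𝓘(ℝ, ℝ) (𝓡 n) 1 γ (Icc a b)) (ht₀ : t₀ ∈ Icc a b)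
    (hv : S.IsFutureTimelike (velocity n γ a b t₀)) :
    ∀ᶠ t in 𝓝[Icc a b \ {t₀}] t₀, ∀ᶠ q in 𝓝 (γ t₀),
      (t < t₀ → S.TimelikeSegment (γ t) q) ∧ (t₀ < t → S.TimelikeSegment q (γ t)) := by
  have hx : γ t₀ ∈ (extChartAt (𝓡 n) (γ t₀)).source := mem_extChartAt_source (γ t₀)
  have hd := hasDerivWithinAt_extChartAt_comp hγ ht₀ hx
  have hline := hd.eventually_line_mem (S.isOpen_chartCone hr (γ t₀))
    ⟨(extChartAt (𝓡 n) (γ t₀)).map_source hx,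
      (S.chartMetric_mfderiv hx _ _).trans_lt hv.1, (S.chartTime_mfderiv hx _).trans_lt hv.2⟩
  have hsource : ∀ᶠ t in 𝓝[Icc a b \ {t₀}] t₀, γ t ∈ (extChartAt (𝓡 n) (γ t₀)).source :=
    ((hγ.continuousOn t₀ ht₀).mono sdiff_subset).eventually (extChartAt_source_mem_nhds (γ t₀))
  filter_upwards [hline, hsource] with t ht hts
  filter_upwards [(continuousAt_extChartAt (γ t₀)).eventually ht,
    extChartAt_source_mem_nhds (I := 𝓡 n) (γ t₀)] with q hq hqs
  obtain ⟨w, hw, hcone⟩ := hq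
  constructor
  · intro hlt
    have := S.timelikeSegment_of_line (sub_pos.2 hlt) hw hcone
    rwa [(extChartAt (𝓡 n) (γ t₀)).left_inv hts, (extChartAt (𝓡 n) (γ t₀)).left_inv hqs] at this
  -- The same chart line is run backwards, from `q` to the later point `γ t`; both signs flip, so
  -- the direction `w` is unchanged.
  · intro hlt
    have := S.timelikeSegment_of_line (x₀ := γ t₀) (x := extChartAt (𝓡 n) (γ t₀) q)
      (y := extChartAt (𝓡 n) (γ t₀) (γ t)) (w := w) (sub_pos.2 hlt)
      (by rw [← neg_sub, hw, ← neg_smul, neg_sub])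
      (fun θ hθ ↦ by
        convert hcone (1 - θ) ⟨sub_nonneg.2 hθ.2, sub_le_self _ hθ.1⟩ using 2
        module)
    rwa [(extChartAt (𝓡 n) (γ t₀)).left_inv hts, (extChartAt (𝓡 n) (γ t₀)).left_inv hqs] at this

variable {S} in
theorem timelikeSegment_of_subset {γ : ℝ → M} {a b a' b' : ℝ}
    (hγ : ContMDiffOn 𝓘(ℝ, ℝ) (𝓡 n) 1 γ (Icc a b))
    (hv : ∀ t ∈ Icc a b, S.IsFutureTimelike (velocity n γ a b t)) (ha : a ≤ a') (hb : b' ≤ b)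
    (hab : a' < b') : S.TimelikeSegment (γ a') (γ b') := by
  have hsub : Icc a' b' ⊆ Icc a b := Icc_subset_Icc ha hb
  refine ⟨γ, a', b', hab, rfl, rfl, hγ.mono hsub, fun t ht ↦ ?_⟩
  rw [velocity_eq_of_subset hγ ha hb hab ht]
  exact hv t (hsub ht)

variable {S} in
theorem TimelikeSegment.exists_eventually_right [IsManifold (𝓡 n) 2 M] (hr : 2 ≤ r) {p q : M}
    (h : S.TimelikeSegment p q) :
    ∃ m, S.TimelikeSegment p m ∧ ∀ᶠ q' in 𝓝 q, S.TimelikeSegment m q' := by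
  obtain ⟨γ, a, b, hab, rfl, rfl, hγ, hv⟩ := h
  have hb : b ∈ Icc a b := right_mem_Icc.2 hab.le
  have h1 := S.eventually_timelikeSegment_of_curve hr hγ hb (hv b hb)
  have hsub : Ioo a b ⊆ Icc a b \ {b} := fun t ht ↦ ⟨Ioo_subset_Icc_self ht, ht.2.ne⟩
  have := right_nhdsWithin_Ioo_neBot hab
  obtain ⟨t, ht, htI⟩ :=
    ((h1.filter_mono (nhdsWithin_mono _ hsub)).and self_mem_nhdsWithin).exists
  exact ⟨γ t, timelikeSegment_of_subset hγ hv le_rfl htI.2.le htI.1, ht.mono fun q hq ↦ hq.1 htI.2⟩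

variable {S} in
theorem TimelikeSegment.exists_eventually_left [IsManifold (𝓡 n) 2 M] (hr : 2 ≤ r) {p q : M}
    (h : S.TimelikeSegment p q) :
    ∃ m, (∀ᶠ p' in 𝓝 p, S.TimelikeSegment p' m) ∧ S.TimelikeSegment m q := by
  obtain ⟨γ, a, b, hab, rfl, rfl, hγ, hv⟩ := h
  have ha : a ∈ Icc a b := left_mem_Icc.2 hab.le
  have h1 := S.eventually_timelikeSegment_of_curve hr hγ ha (hv a ha)
  have hsub : Ioo a b ⊆ Icc a b \ {a} := fun t ht ↦ ⟨Ioo_subset_Icc_self ht, ht.1.ne'⟩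
  have := left_nhdsWithin_Ioo_neBot hab
  obtain ⟨t, ht, htI⟩ :=
    ((h1.filter_mono (nhdsWithin_mono _ hsub)).and self_mem_nhdsWithin).exists
  exact ⟨γ t, ht.mono fun q hq ↦ hq.2 htI.1, timelikeSegment_of_subset hγ hv htI.1.le le_rfl htI.2⟩

/-- The chronological relation is open. -/
theorem isOpen_chronologicalRel [IsManifold (𝓡 n) 2 M] (hr : 2 ≤ r) :
    IsOpen S.chronologicalRel := by
  rw [isOpen_iff_mem_nhds]
  rintro ⟨p, q⟩ (h : Relation.TransGen S.TimelikeSegment p q)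
  -- The left end is freed first and the right end in the remaining chain from `m`, so a chain of a
  -- single segment needs no separate case.
  obtain ⟨m, hpm, hmq⟩ : ∃ m, (∀ᶠ p' in 𝓝 p, S.TimelikeSegment p' m) ∧
      Relation.TransGen S.TimelikeSegment m q := by
    obtain ⟨c, hpc, hcq⟩ := Relation.TransGen.head'_iff.1 h
    obtain ⟨m, hm, hmc⟩ := hpc.exists_eventually_left hr
    exact ⟨m, hm, Relation.TransGen.head' hmc hcq⟩
  obtain ⟨c, hmc, hcq⟩ := Relation.TransGen.tail'_iff.1 hmq
  obtain ⟨m', hcm', hm'q⟩ := hcq.exists_eventually_right hr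
  filter_upwards [hpm.prod_nhds hm'q] with z hz
  exact (Relation.TransGen.head' hz.1 (hmc.tail hcm')).tail hz.2

/-- A point chronologically preceding all points of a causal curve but the last one precedes
the last one as well. -/
theorem chronological_right_endpoint [IsManifold (𝓡 n) 2 M] (hr : 2 ≤ r) {p : M} {γ : ℝ → M}
    {a b : ℝ} (hab : a < b) (hγ : ContMDiffOn 𝓘(ℝ, ℝ) (𝓡 n) 1 γ (Icc a b))
    (hv : ∀ t ∈ Icc a b, S.IsFutureCausal (velocity n γ a b t))
    (hp : ∀ t ∈ Ico a b, (p, γ t) ∈ S.chronologicalRel) : (p, γ b) ∈ S.chronologicalRel := by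
  have hbI : b ∈ Icc a b := right_mem_Icc.2 hab.le
  have hx : γ b ∈ (extChartAt (𝓡 n) (γ b)).source := mem_extChartAt_source (γ b)
  obtain ⟨η, hη, hηs⟩ := Metric.mem_nhdsWithin_iff.1
    ((hγ.continuousOn b hbI).eventually (extChartAt_source_mem_nhds (I := 𝓡 n) (γ b)))
  obtain ⟨a', ha1, ha2⟩ := exists_between (max_lt hab (sub_lt_self b hη))
  have haa : a ≤ a' := ((le_max_left _ _).trans_lt ha1).le
  have hsub : Icc a' b ⊆ Icc a b := Icc_subset_Icc haa le_rfl
  have hsource (t : ℝ) (ht : t ∈ Icc a' b) : γ t ∈ (extChartAt (𝓡 n) (γ b)).source := by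
    refine hηs ⟨?_, hsub ht⟩
    have := (le_max_right a (b - η)).trans_lt ha1
    rw [Metric.mem_ball, Real.dist_eq, abs_sub_lt_iff]
    constructor <;> linarith [ht.1, ht.2]
  have hγ' := hγ.mono hsub
  have hv' (t : ℝ) (ht : t ∈ Icc a' b) : S.IsFutureCausal (velocity n γ a' b t) := by
    rw [velocity_eq_of_subset hγ haa le_rfl ha2 ht]
    exact hv t (hsub ht)
  have hbI' : b ∈ Icc a' b := right_mem_Icc.2 ha2.le
  have hcC : ContDiffOn ℝ 1 (fun t ↦ extChartAt (𝓡 n) (γ b) (γ t)) (Icc a' b) := by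
    rw [← contMDiffOn_iff_contDiffOn]
    refine (contMDiffOn_extChartAt (n := 1)).comp hγ' fun t ht ↦ ?_
    simpa using hsource t ht
  -- The push direction `e` is the orienting vector `T` at the end point, read in the chart: it
  -- pairs negatively with itself and with every future causal vector there.
  obtain ⟨s, hs, hpert⟩ := exists_timelike_perturbation (isOpen_extChartAt_target (I := 𝓡 n) (γ b))
    (S.contDiffOn_chartMetric hr (γ b)) (S.continuousOn_chartTime (γ b)) (S.chartMetric_symm (γ b))
    ha2 hcC (fun t ht ↦ hasDerivWithinAt_extChartAt_comp hγ' ht (hsource t ht))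
    ((extChartAt (𝓡 n) (γ b)).map_source hx)
    (fun t ht ↦ (S.chartMetric_mfderiv (hsource t ht) _ _).trans_le (hv' t ht).2.1)
    (e := mfderiv (𝓡 n) 𝓘(ℝ, 𝔼 n) (extChartAt (𝓡 n) (γ b)) (γ b) (S.T (γ b)))
    ((S.chartMetric_mfderiv hx _ _).trans_lt (S.timelike_T _))
    ((S.chartMetric_mfderiv hx _ _).trans_lt (hv' b hbI').2.2)
    ((S.chartTime_mfderiv hx _).trans_lt (hv' b hbI').2.2)
    ((S.chartTime_mfderiv hx _).trans_lt (S.timelike_T _))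
  have hsI : s ∈ Icc a' b := ⟨hs.1, hs.2.le⟩
  have hps := hp s ⟨haa.trans hs.1, hs.2⟩
  have hcont : ContinuousAt (fun y ↦ (p, (extChartAt (𝓡 n) (γ b)).symm y))
      (extChartAt (𝓡 n) (γ b) (γ s)) :=
    continuousAt_const.prodMk (continuousAt_extChartAt_symm' (hsource s hsI))
  -- Since $I^+$ is open, a start close enough to `γ s` is still chronologically after `p`; the
  -- perturbed timelike curve then leads to `γ b` itself.
  have hU := hcont.preimage_mem_nhds ((S.isOpen_chronologicalRel hr).mem_nhds (by
    rwa [(extChartAt (𝓡 n) (γ b)).left_inv (hsource s hsI)]))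
  obtain ⟨c, v, hcs, hcb, hc, hcv, hcone⟩ := hpert _ hU
  have hseg := S.timelikeSegment_of_chart (x₀ := γ b) hs.2 hc hcv hcone
  rw [hcb, (extChartAt (𝓡 n) (γ b)).left_inv hx] at hseg
  exact Relation.TransGen.tail hcs hseg

variable {S} in
-- The parameters at which the curve is outside $I^+(p)$ form a closed set, by openness of $I^+$. A
-- least such parameter cannot be the initial one, and `chronological_right_endpoint` excludes any
-- later one.
theorem CausalSegment.chronological_trans [IsManifold (𝓡 n) 2 M] (hr : 2 ≤ r) {p q q' : M}
    (h : S.CausalSegment q q') (hpq : (p, q) ∈ S.chronologicalRel) :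
    (p, q') ∈ S.chronologicalRel := by
  obtain ⟨γ, a, b, hab, rfl, rfl, hγ, hv⟩ := h
  by_contra hpb
  let B : Set ℝ := Icc a b ∩ {t | (p, γ t) ∉ S.chronologicalRel}
  have hclosed : IsClosed B :=
    (continuousOn_const.prodMk hγ.continuousOn).preimage_isClosed_of_isClosed isClosed_Icc
      (S.isOpen_chronologicalRel hr).isClosed_compl
  have hne : B.Nonempty := ⟨b, right_mem_Icc.2 hab.le, hpb⟩
  have hbdd : BddBelow B := ⟨a, fun t ht ↦ ht.1.1⟩
  have hmem : sInf B ∈ B := hclosed.csInf_mem hne hbdd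
  have hlt : a < sInf B := lt_of_le_of_ne hmem.1.1 fun he ↦ hmem.2 (he ▸ hpq)
  refine hmem.2 (S.chronological_right_endpoint hr hlt
    (hγ.mono (Icc_subset_Icc le_rfl hmem.1.2)) (fun t ht ↦ ?_) fun t ht ↦ ?_)
  · rw [velocity_eq_of_subset hγ le_rfl hmem.1.2 hlt ht]
    exact hv t ⟨ht.1, ht.2.trans hmem.1.2⟩
  · by_contra hpt
    exact (csInf_le hbdd ⟨⟨ht.1, ht.2.le.trans hmem.1.2⟩, hpt⟩).not_gt ht.2

/-- The push-up property `I⁺ ∘ J⁺ ⊆ I⁺`. -/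
theorem chronologicalRel_of_causalRel [IsManifold (𝓡 n) 2 M] (hr : 2 ≤ r) {p q q' : M}
    (hpq : (p, q) ∈ S.chronologicalRel) (hqq : (q, q') ∈ S.causalRel) :
    (p, q') ∈ S.chronologicalRel := by
  obtain (rfl : q = q') | (h : Relation.TransGen S.CausalSegment q q') := hqq
  · exact hpq
  · induction h with
    | single h => exact h.chronological_trans hr hpq
    | tail _ h ih => exact h.chronological_trans hr ih

theorem chronologicalRel_subset_causalRel : S.chronologicalRel ⊆ S.causalRel := by
  rintro ⟨p, q⟩ (h : Relation.TransGen S.TimelikeSegment p q)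
  refine Or.inr (Relation.TransGen.mono (fun x y hxy ↦ ?_) p q h)
  obtain ⟨γ, a, b, hab, ha, hb, hγ, hv⟩ := hxy
  refine ⟨γ, a, b, hab, ha, hb, hγ, fun t ht ↦ ⟨fun h0 ↦ ?_, (hv t ht).1.le, (hv t ht).2⟩⟩
  have := (hv t ht).1
  rw [h0] at this
  simp at this

/-- In a chronological spacetime, no chronological pair is reversed in the closure of `J⁺`. -/
theorem swap_notMem_closure_causalRel [IsManifold (𝓡 n) 2 M] (hr : 2 ≤ r)
    (hchron : S.IsChronological) {p q : M} (hpq : (p, q) ∈ S.chronologicalRel) :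
    (q, p) ∉ closure S.causalRel := by
  intro hqp
  have hopen : IsOpen (Prod.swap ⁻¹' S.chronologicalRel) :=
    (S.isOpen_chronologicalRel hr).preimage continuous_swap
  obtain ⟨⟨y, x⟩, hxy, hyx⟩ := mem_closure_iff.1 hqp _ hopen hpq
  exact hchron x (S.chronologicalRel_of_causalRel hr hxy hyx)

end LorentzianTimeOriented

/-! ### Assembly of the two halves. -/

theorem mainTheorem5 (n : ℕ) (hn : 2 ≤ n) (r : ℕ∞) (hr : 3 ≤ r)
    (M : Type*) [TopologicalSpace M] [T2Space M] [ParacompactSpace M] [ConnectedSpace M]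
    [ChartedSpace (EuclideanSpace ℝ (Fin n)) M] [IsManifold (𝓡 n) 1 M]
    [IsManifold (𝓡 n) (r : ℕ∞ω) M]
    (S : LorentzianTimeOriented n r M)
    (hchron : S.IsChronological)
    (htrans : SetRel.IsTrans (closure S.causalRel)) :
    S.kRel = closure S.causalRel ∧
    (∃ u : M → ℝ, Continuous u ∧ IsUtility S.kRel u) ∧
    (∀ u : M → ℝ, Continuous u → IsUtility S.kRel u → S.IsSemiTime u) ∧
    (∃ t : M → ℝ, S.IsSemiTime t) := by
  have hr2 : (2 : ℕ∞) ≤ r := le_trans (by norm_num) hr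
  have : IsManifold (𝓡 n) 2 M := .of_le (n := (r : ℕ∞ω)) (WithTop.coe_le_coe.2 hr2)
  have : LocallyCompactSpace M := Manifold.locallyCompact_of_finiteDimensional (𝓡 n)
  have : SigmaCompactSpace M := sigmaCompactSpace_of_paracompact_of_connected
  have : SecondCountableTopology M :=
    ChartedSpace.secondCountable_of_sigmaCompact (EuclideanSpace ℝ (Fin n)) M
  have hK : S.kRel = closure S.causalRel :=
    subset_antisymm (sInter_subset_of_mem ⟨isClosed_closure, htrans, subset_closure⟩)
      (subset_sInter fun R hR ↦ closure_minimal hR.2.2 hR.1)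
  have hu : ∃ u : M → ℝ, Continuous u ∧ IsUtility S.kRel u := by
    rw [hK]
    exact exists_continuous_isUtility isClosed_closure (fun x ↦ subset_closure (Or.inl rfl))
      fun x y z hxy hyz ↦ htrans.trans x y z hxy hyz
  have hsemi (u : M → ℝ) (huc : Continuous u) (huu : IsUtility S.kRel u) : S.IsSemiTime u := by
    rw [hK] at huu
    -- A pair in $I^+$ lies in $\overline{J^+}$ and is not reversed there, so it is strict for the
    -- preorder and the utility must increase.
    exact ⟨huc, fun p q hpq ↦ huu.2 p q ⟨subset_closure (S.chronologicalRel_subset_causalRel hpq),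
      fun h ↦ S.swap_notMem_closure_causalRel hr2 hchron hpq h.2⟩⟩
  obtain ⟨u, huc, huu⟩ := hu
  exact ⟨hK, ⟨u, huc, huu⟩, hsemi, u, hsemi u huc huu⟩
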